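/- Let $d\ge 0$ be an integer and, for a topological vector space $V$, let $M^1(V)$ be the set of Borel probability measures on $V$, with the topology of weak convergence. For $\rho\in M^1(V)$ and a continuous linear map $T$ write $T(\rho)$ for the image measure, and let $*$ denote convolution. Let $(\mu_k)_{k\in\mathbb Z}$ be a bi-sequence in $M^1(\mathbb R^d)$ and let $\phi$ be an invertible linear map of $\mathbb R^d$. Consider the equation $$\lambda_k=\mu_k*\phi(\lambda_{k-1}),\qquad k\in\mathbb Z, \tag{1}$$ for bi-sequences $(\lambda_k)_{k\in\mathbb Z}$ in $M^1(\mathbb R^d)$. A solution $(\lambda_k)$ of (1) is called a fundamental solution if for every solution $(\nu_k)$ of (1) there is a $\nu\in M^1(\mathbb R^d)$ such that $\nu_k=\lambda_k*\phi^k(\nu)$ for all $k\in\mathbb Z$. Let $(\mathbb R^d)^{\mathbb Z}$ be the space of all bi-sequences in $\mathbb R^d$ with the product topology, let $P_k$ be its $k$-th coordinate projection, and let $\tau$ be the continuous linear operator on $(\mathbb R^d)^{\mathbb Z}$ given by $\tau((v_i)_i)=(\phi(v_{i-1}))_i$. Let $\mu=\bigotimes_{k\in\mathbb Z}\mu_k\in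 M^1((\mathbb R^d)^{\mathbb Z})$ be the product measure. For $\lambda,\kappa\in M^1((\mathbb R^d)^{\mathbb Z})$, say that $\lambda$ is strongly $\tau$-decomposable with co-factor $\kappa$ if $\lambda=\kappa*\tau(\lambda)$ and $\tau^n(\lambda)\to\delta_0$ weakly as $n\to\infty$. Then: (i) If $\lambda\in M^1((\mathbb R^d)^{\mathbb Z})$ is strongly $\tau$-decomposable with co-factor $\mu$, then $(P_k(\lambda))_{k\in\mathbb Z}$ is a fundamental solution of (1). (ii) If (1) has a solution, then there are a $v\in(\mathbb R^d)^{\mathbb Z}$ and a strongly $\tau$-decomposable measure on $(\mathbb R^d)^{\mathbb Z}$ with co-factor $\mu*\delta_v$. Moreover, in this case (1) has a fundamental solution. -/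

import Mathlib

open MeasureTheory Filter Topology

namespace StochDiffEq

noncomputable section

/-- The Euclidean space `ℝ^d`. -/
abbrev Euc (d : ℕ) : Type := EuclideanSpace ℝ (Fin d)

/-- The space `(ℝ^d)^ℤ` of all bi-sequences of vectors in `ℝ^d`. It carries the product topology
(coordinatewise convergence), and its product sigma-algebra is the Borel sigma-algebra. -/
abbrev BiSeq (d : ℕ) : Type := ℤ → Euc d

section General

variable {V W : Type*}
  [AddCommGroup V] [Module ℝ V] [TopologicalSpace V] [MeasurableSpace V] [BorelSpace V]
  [AddCommGroup W] [Module ℝ W] [TopologicalSpace W] [MeasurableSpace W] [BorelSpace W]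

/-- The image `T(ρ)` of a Borel probability measure under a continuous linear map. -/
def image (T : V →L[ℝ] W) (ρ : ProbabilityMeasure V) : ProbabilityMeasure W :=
  ρ.map T.continuous.measurable.aemeasurable

/-- The convolution `μ * ν` of two Borel probability measures. -/
def conv [MeasurableAdd₂ V] (μ ν : ProbabilityMeasure V) : ProbabilityMeasure V :=
  ⟨Measure.conv (μ : Measure V) (ν : Measure V), inferInstance⟩

/-- `ρ` is `T`-decomposable with co-factor `ν`: `ρ = ν * T(ρ)`. -/
def IsDecomposable [MeasurableAdd₂ V] (T : V →L[ℝ] V) (ρ ν : ProbabilityMeasure V) : Prop :=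
  ρ = conv ν (image T ρ)

/-- `ρ` is strongly `T`-decomposable with co-factor `ν`: it is `T`-decomposable with co-factor `ν`
and `T^n(ρ)` converges weakly to the Dirac measure at `0`. -/
def IsStronglyDecomposable [MeasurableAdd₂ V] (T : V →L[ℝ] V) (ρ ν : ProbabilityMeasure V) :
    Prop :=
  IsDecomposable T ρ ν ∧ Tendsto (fun n : ℕ => image (T ^ n) ρ) atTop (𝓝 (diracProba (0 : V)))

end General

variable {d : ℕ}

/-- The weighted shift `τ` on `(ℝ^d)^ℤ`, given by `(τ v) i = φ (v (i - 1))`. -/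
def weightedShift (φ : Euc d →L[ℝ] Euc d) : BiSeq d →L[ℝ] BiSeq d :=
  ContinuousLinearMap.pi fun i : ℤ => φ.comp (ContinuousLinearMap.proj (i - 1))

/-- The `k`-th coordinate projection `P_k`. -/
def coordProj (k : ℤ) : BiSeq d →L[ℝ] Euc d := ContinuousLinearMap.proj k

/-- The probability measure on `(ℝ^d)^ℤ` associated with a bi-sequence `(μ_k)` by Kolmogorov's
theorem: the infinite product, under which the coordinates are independent with laws `μ_k`. -/
def productLaw (μ : ℤ → ProbabilityMeasure (Euc d)) : ProbabilityMeasure (BiSeq d) :=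
  ⟨Measure.infinitePi fun k => (μ k : Measure (Euc d)), inferInstance⟩

/-- `(lam_k)` solves `lam_k = μ_k * φ(lam_{k-1})` for all `k ∈ ℤ`. -/
def IsSolution (φ : Euc d →L[ℝ] Euc d) (μ lam : ℤ → ProbabilityMeasure (Euc d)) : Prop :=
  ∀ k : ℤ, lam k = conv (μ k) (image φ (lam (k - 1)))

/-- `(lam_k)` is a fundamental solution: it is a solution and every solution `(ν_k)` has the form
`ν_k = lam_k * φ^k(ν)`, `k ∈ ℤ`, for some probability measure `ν` on `ℝ^d`.
Here `φ ^ k` is the integer power in the group of invertible linear maps. -/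
def IsFundamentalSolution (φ : Euc d ≃L[ℝ] Euc d) (μ lam : ℤ → ProbabilityMeasure (Euc d)) :
    Prop :=
  IsSolution (φ : Euc d →L[ℝ] Euc d) μ lam ∧
    ∀ ν' : ℤ → ProbabilityMeasure (Euc d), IsSolution (φ : Euc d →L[ℝ] Euc d) μ ν' →
      ∃ ν : ProbabilityMeasure (Euc d), ∀ k : ℤ,
        ν' k = conv (lam k) (image ((φ ^ k : Euc d ≃L[ℝ] Euc d) : Euc d →L[ℝ] Euc d) ν)

end

end StochDiffEq

/-! Untwisting by `x k = φ^(-k)(lam k)` and `η k = φ^(-k)(μ k)` turns (1) into `x k = η k * x (k -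
1)`. Everything rests on one property of a solution `x`: some translates of `x (-n)` tend to `δ₀`.

Such an `x` divides every solution `y` (`IsConvSolution.exists_eq_conv`). By commutativity `y k * x
(-n) = x k * y (-n)`; after translation the left side tends to `y k`, the translated `y (-n)` are
tight, and any limit point `ν` gives `y k = x k * ν` for all `k` at once. In (i), coordinate 0 of
`τ^n(lam)` is `x (-n)`, so the property holds with zero translations.

For (ii), `IsConvSolution.exists_concentrating` builds such an `x` from any solution `y`. The
partial products `η 0 * ⋯ * η (1-n)` are factors of `y 0`, hence tight up to translations; limits
along one ultrafilter give a solution `x`. Passing to the limit in `x 0` = (translated partial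
product) * (translated `x (-n)`) yields `x 0 = x 0 * θ`, which forces `θ = δ₀`. Monotonicity of
`spread` upgrades this ultrafilter limit to a genuine one. A product law built from translates of
`x` is then strongly `τ`-decomposable. -/

namespace StochDiffEq

set_option linter.unusedSectionVars false

/-! ### Convolution algebra and images under linear maps. -/

section Conv

variable {V W X : Type*}
  [AddCommGroup V] [Module ℝ V] [TopologicalSpace V] [MeasurableSpace V] [BorelSpace V]
  [AddCommGroup W] [Module ℝ W] [TopologicalSpace W] [MeasurableSpace W] [BorelSpace W]
  [AddCommGroup X] [Module ℝ X] [TopologicalSpace X] [MeasurableSpace X] [BorelSpace X]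

lemma conv_comm [MeasurableAdd₂ V] (α β : ProbabilityMeasure V) : conv α β = conv β α :=
  Subtype.ext (Measure.conv_comm _ _)

lemma conv_assoc [MeasurableAdd₂ V] (α β γ : ProbabilityMeasure V) :
    conv (conv α β) γ = conv α (conv β γ) :=
  Subtype.ext (Measure.conv_assoc _ _ _)

lemma conv_left_comm [MeasurableAdd₂ V] (α β γ : ProbabilityMeasure V) :
    conv α (conv β γ) = conv β (conv α γ) := by
  rw [← conv_assoc, conv_comm α, conv_assoc]

lemma conv_diracProba_zero [MeasurableAdd₂ V] (α : ProbabilityMeasure V) :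
    conv α (diracProba 0) = α :=
  Subtype.ext (Measure.conv_dirac_zero _)

lemma diracProba_zero_conv [MeasurableAdd₂ V] (α : ProbabilityMeasure V) :
    conv (diracProba 0) α = α :=
  Subtype.ext (Measure.dirac_zero_conv _)

lemma conv_diracProba_diracProba [MeasurableAdd₂ V] (x y : V) :
    conv (diracProba x) (diracProba y) = diracProba (x + y) :=
  Subtype.ext (Measure.dirac_conv_dirac _ _)

lemma image_conv [MeasurableAdd₂ V] [MeasurableAdd₂ W] (T : V →L[ℝ] W)
    (α β : ProbabilityMeasure V) : image T (conv α β) = conv (image T α) (image T β) :=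
  Subtype.ext (Measure.map_conv_continuousLinearMap T)

lemma image_image (S : W →L[ℝ] X) (T : V →L[ℝ] W) (α : ProbabilityMeasure V) :
    image S (image T α) = image (S.comp T) α :=
  Subtype.ext (Measure.map_map S.continuous.measurable T.continuous.measurable)

lemma image_id (α : ProbabilityMeasure V) : image (ContinuousLinearMap.id ℝ V) α = α :=
  Subtype.ext Measure.map_id

lemma image_diracProba (T : V →L[ℝ] W) (x : V) : image T (diracProba x) = diracProba (T x) :=
  Subtype.ext (Measure.map_dirac' T.continuous.measurable x)

lemma tendsto_image {ι : Type*} {l : Filter ι} (T : V →L[ℝ] W) {α : ι → ProbabilityMeasure V}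
    {a : ProbabilityMeasure V} (h : Tendsto α l (𝓝 a)) :
    Tendsto (fun i => image T (α i)) l (𝓝 (image T a)) :=
  ProbabilityMeasure.tendsto_map_of_tendsto_of_continuous _ _ h T.continuous

end Conv

section Normed

variable {E : Type*} [NormedAddCommGroup E] [InnerProductSpace ℝ E] [FiniteDimensional ℝ E]
  [MeasurableSpace E] [BorelSpace E]

lemma tendsto_conv {ι : Type*} {l : Filter ι} {α β : ι → ProbabilityMeasure E}
    {a b : ProbabilityMeasure E} (hα : Tendsto α l (𝓝 a)) (hβ : Tendsto β l (𝓝 b)) :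
    Tendsto (fun i => conv (α i) (β i)) l (𝓝 (conv a b)) :=
  ProbabilityMeasure.tendsto_map_of_tendsto_of_continuous _ _
    ((ProbabilityMeasure.continuous_prod.tendsto (a, b)).comp (hα.prodMk_nhds hβ))
    (continuous_fst.add continuous_snd)

end Normed

/-! ### Weak convergence to a point mass. -/

section Dirac

variable {Ω ι : Type*} [TopologicalSpace Ω] [MeasurableSpace Ω] [OpensMeasurableSpace Ω]

lemma tendsto_diracProba_of_forall_mem_nhds {l : Filter ι} [l.IsCountablyGenerated]
    {ρ : ι → ProbabilityMeasure Ω} {x : Ω}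
    (h : ∀ s ∈ 𝓝 x, Tendsto (fun i => (ρ i : Measure Ω) sᶜ) l (𝓝 0)) :
    Tendsto ρ l (𝓝 (diracProba x)) := by
  rcases l.eq_or_neBot with rfl | hl
  · exact tendsto_bot
  refine tendsto_of_forall_isClosed_limsup_le' fun F hF => ?_
  by_cases hx : x ∈ F
  · rw [diracProba_toMeasure_apply_of_mem hx]
    exact limsup_le_of_le (h := Eventually.of_forall fun i => prob_le_one)
  · have := (h Fᶜ (hF.isOpen_compl.mem_nhds hx)).limsup_eq
    rw [compl_compl] at this
    rw [this]
    exact zero_le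

lemma tendsto_measure_compl_of_tendsto_diracProba [HasOuterApproxClosed Ω] {l : Filter ι}
    {ρ : ι → ProbabilityMeasure Ω} {x : Ω} (h : Tendsto ρ l (𝓝 (diracProba x)))
    {s : Set Ω} (hs : s ∈ 𝓝 x) : Tendsto (fun i => (ρ i : Measure Ω) sᶜ) l (𝓝 0) := by
  rcases l.eq_or_neBot with rfl | hl
  · exact tendsto_bot
  obtain ⟨t, hts, ht, hxt⟩ := mem_nhds_iff.1 hs
  have h1 : limsup (fun i => (ρ i : Measure Ω) tᶜ) l ≤ 0 := by
    refine (ProbabilityMeasure.limsup_measure_closed_le_of_tendsto h ht.isClosed_compl).trans ?_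
    rw [diracProba_toMeasure_apply' _ ht.measurableSet.compl]
    simp [hxt]
  have h2 : Tendsto (fun i => (ρ i : Measure Ω) tᶜ) l (𝓝 0) :=
    tendsto_of_le_liminf_of_limsup_le zero_le h1
  exact tendsto_of_tendsto_of_tendsto_of_le_of_le tendsto_const_nhds h2 (fun _ => zero_le)
    fun i => measure_mono (Set.compl_subset_compl.2 hts)

end Dirac

/-! ### Tightness of sequences and of their convolution factors. -/

section Tight

open scoped ENNReal NNReal

variable {E : Type*} [NormedAddCommGroup E] [InnerProductSpace ℝ E] [FiniteDimensional ℝ E]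
  [MeasurableSpace E] [BorelSpace E]

/-- Uniform tightness of a sequence of probability measures, up to finitely many terms. -/
def TightSeq (ρ : ℕ → ProbabilityMeasure E) : Prop :=
  ∀ ε : ℝ≥0∞, 0 < ε → ∃ R : ℝ, ∀ᶠ n in atTop, (ρ n : Measure E) {x | R < ‖x‖} ≤ ε

/-- Prokhorov's theorem. Working with an ultrafilter avoids extracting subsequences, so one filter
serves all indices `k` simultaneously. -/
lemma TightSeq.exists_tendsto {ρ : ℕ → ProbabilityMeasure E} (h : TightSeq ρ)
    {U : Ultrafilter ℕ} : ∃ κ, Tendsto ρ U (𝓝 κ) := by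
  have : ProperSpace E := FiniteDimensional.proper ℝ E
  have h1 : IsTightMeasureSet (Set.range fun n => (ρ n : Measure E)) := by
    refine isTightMeasureSet_range_of_tendsto_limsup_measure_norm_gt ?_
    refine ENNReal.tendsto_nhds_zero.2 fun ε hε => ?_
    obtain ⟨R, hR⟩ := h ε hε
    filter_upwards [eventually_ge_atTop R] with r hr
    refine limsup_le_of_le (h := ?_)
    filter_upwards [hR] with n hn
    exact (measure_mono fun x hx => lt_of_le_of_lt hr hx).trans hn
  have h2 : IsCompact (closure (Set.range ρ)) := by
    refine isCompact_closure_of_isTightMeasureSet ?_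
    convert h1 using 1
    ext m
    simp
  obtain ⟨κ, -, hκ⟩ := h2.ultrafilter_le_nhds (U.map ρ)
    (by
      rw [le_principal_iff]
      exact mem_map.2 (Filter.univ_mem' fun n => subset_closure ⟨n, rfl⟩))
  exact ⟨κ, hκ⟩

lemma tendsto_measure_norm_ge (κ : ProbabilityMeasure E) :
    Tendsto (fun m : ℕ => (κ : Measure E) {x | (m : ℝ) ≤ ‖x‖}) atTop (𝓝 0) := by
  have h := tendsto_measure_iInter_atTop (μ := (κ : Measure E))
    (s := fun m : ℕ => {x : E | (m : ℝ) ≤ ‖x‖})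
    (fun m => (measurableSet_le measurable_const measurable_norm).nullMeasurableSet)
    (fun a b hab x (hx : (b : ℝ) ≤ ‖x‖) =>
      show (a : ℝ) ≤ ‖x‖ from le_trans (Nat.cast_le.2 hab) hx) ⟨0, measure_ne_top _ _⟩
  have h0 : ⋂ m : ℕ, {x : E | (m : ℝ) ≤ ‖x‖} = ∅ := by
    ext x
    simp only [Set.mem_iInter, Set.mem_empty_iff_false, iff_false, not_forall]
    obtain ⟨m, hm⟩ := exists_nat_gt ‖x‖
    exact ⟨m, not_le.2 hm⟩
  rw [h0, measure_empty] at h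
  exact h

lemma tightSeq_of_tendsto {ρ : ℕ → ProbabilityMeasure E} {κ : ProbabilityMeasure E}
    (h : Tendsto ρ atTop (𝓝 κ)) : TightSeq ρ := by
  intro ε hε
  obtain ⟨m, hm⟩ := ((tendsto_measure_norm_ge κ).eventually_lt_const hε).exists
  refine ⟨m, ?_⟩
  have hc : IsClosed {x : E | (m : ℝ) ≤ ‖x‖} := isClosed_le continuous_const continuous_norm
  have := (ProbabilityMeasure.limsup_measure_closed_le_of_tendsto h hc).trans_lt hm
  filter_upwards [eventually_lt_of_limsup_lt this] with n hn
  exact (measure_mono fun x (hx : (m : ℝ) < ‖x‖) => hx.le).trans hn.le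

lemma tightSeq_const (κ : ProbabilityMeasure E) : TightSeq fun _ => κ :=
  tightSeq_of_tendsto tendsto_const_nhds

lemma measure_mul_le_measure_conv (α β : ProbabilityMeasure E) (R S : ℝ) :
    (α : Measure E) {x | ‖x‖ ≤ S} * (β : Measure E) {x | R + S < ‖x‖} ≤
      (conv α β : Measure E) {x | R < ‖x‖} := by
  have hm : MeasurableSet {x : E | R < ‖x‖} := measurableSet_lt measurable_const measurable_norm
  change _ ≤ Measure.map (fun p : E × E => p.1 + p.2) ((α : Measure E).prod β) _
  rw [Measure.map_apply (by fun_prop) hm, ← Measure.prod_prod]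
  refine measure_mono ?_
  rintro ⟨x, y⟩ ⟨hx, hy⟩
  simp only [Set.mem_ofPred_eq, Set.mem_preimage] at hx hy ⊢
  have := norm_sub_le (x + y) x
  rw [add_sub_cancel_left] at this
  linarith

/-- A co-factor of a tight sequence in a tight sequence is tight. -/
lemma TightSeq.of_conv {α β γ : ℕ → ProbabilityMeasure E} (hγ : TightSeq γ) (hα : TightSeq α)
    (h : ∀ᶠ n in atTop, γ n = conv (α n) (β n)) : TightSeq β := by
  intro ε hε
  -- Once `α n` gives mass at least 1/2 to a ball of radius `S`, tails of `β n` are at most twice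
  -- tails of `γ n`, with the radius enlarged by `S`.
  obtain ⟨S, hS⟩ := hα 2⁻¹ (by simp)
  obtain ⟨R, hR⟩ := hγ (2⁻¹ * ε) (ENNReal.mul_pos (by simp) hε.ne')
  refine ⟨R + S, ?_⟩
  filter_upwards [hS, hR, h] with n hS hR hn
  have h1 : 2⁻¹ ≤ (α n : Measure E) {x | ‖x‖ ≤ S} := by
    have hm : MeasurableSet {x : E | S < ‖x‖} := measurableSet_lt measurable_const measurable_norm
    have hc : {x : E | ‖x‖ ≤ S} = {x : E | S < ‖x‖}ᶜ := by ext; simp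
    rw [hc, prob_compl_eq_one_sub hm]
    calc (2⁻¹ : ℝ≥0∞) = 1 - 2⁻¹ := ENNReal.one_sub_inv_two.symm
      _ ≤ _ := by gcongr
  have h2 := measure_mul_le_measure_conv (α n) (β n) R S
  rw [← hn] at h2
  have h3 : 2⁻¹ * (β n : Measure E) {x | R + S < ‖x‖} ≤ 2⁻¹ * ε :=
    le_trans (by gcongr) (h2.trans hR)
  exact (ENNReal.mul_le_mul_iff_right (by simp) (by simp)).1 h3

/-- By Fubini the right side is the `β`-average of the left side over `a`, and some value does not
exceed the average. -/
lemma exists_lintegral_conv_diracProba_le (α β : ProbabilityMeasure E) {f : E → ℝ≥0∞}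
    (hf : Measurable f) : ∃ a : E,
      ∫⁻ x, f x ∂(conv α (diracProba a) : Measure E) ≤ ∫⁻ x, f x ∂(conv α β : Measure E) := by
  have h1 : ∫⁻ x, f x ∂(conv α β : Measure E) =
      ∫⁻ a, ∫⁻ x, f (a + x) ∂(α : Measure E) ∂(β : Measure E) := by
    rw [conv_comm]
    exact Measure.lintegral_conv hf
  obtain ⟨a, ha⟩ := exists_le_lintegral (μ := (β : Measure E))
    (f := fun a => ∫⁻ x, f (a + x) ∂(α : Measure E)) (by fun_prop)
  refine ⟨a, ?_⟩
  rw [h1]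
  refine le_trans (le_of_eq ?_) ha
  rw [conv_comm]
  refine (Measure.lintegral_conv (μ := Measure.dirac a) hf).trans ?_
  rw [lintegral_dirac' _ (by fun_prop)]

/-- Left factors of a fixed measure are tight up to translations. -/
lemma exists_tightSeq_conv_diracProba {ρ : ProbabilityMeasure E} {α β : ℕ → ProbabilityMeasure E}
    (h : ∀ n, conv (α n) (β n) = ρ) :
    ∃ a : ℕ → E, TightSeq fun n => conv (α n) (diracProba (a n)) := by
  have hR : ∀ m : ℕ, ∃ R : ℕ, (ρ : Measure E) {x | (R : ℝ) ≤ ‖x‖} < 2⁻¹ ^ m := fun m =>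
    ((tendsto_measure_norm_ge ρ).eventually_lt_const
      (ENNReal.pow_pos (by simp) m)).exists
  choose R hR using hR
  have hm : ∀ m, MeasurableSet {x : E | (R m : ℝ) ≤ ‖x‖} := fun m =>
    measurableSet_le measurable_const measurable_norm
  -- A `ρ`-integrable weight that is at least `m` outside the ball of radius `R m`: averaging
  -- chooses `a n` keeping its integral bounded by that of `ρ`, and Markov's inequality then gives
  -- tightness.
  let f : E → ℝ≥0∞ := fun x => ∑' m : ℕ, (m : ℝ≥0∞) * Set.indicator {x | (R m : ℝ) ≤ ‖x‖} 1 x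
  have hf : Measurable f :=
    Measurable.tsum fun m => (measurable_one.indicator (hm m)).const_mul _
  have hρ : ∫⁻ x, f x ∂(ρ : Measure E) ≠ ∞ := by
    have : ∫⁻ x, f x ∂(ρ : Measure E) =
        ∑' m : ℕ, (m : ℝ≥0∞) * (ρ : Measure E) {x | (R m : ℝ) ≤ ‖x‖} := by
      rw [lintegral_tsum fun m => ((measurable_one.indicator (hm m)).const_mul _).aemeasurable]
      congr with m
      rw [lintegral_const_mul _ (measurable_one.indicator (hm m)), lintegral_indicator_one (hm m)]
    rw [this]
    have hs : Summable fun m : ℕ => (m : ℝ≥0) * 2⁻¹ ^ m := by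
      rw [← NNReal.summable_coe]
      simpa using summable_pow_mul_geometric_of_norm_lt_one 1 (r := (2⁻¹ : ℝ)) (by norm_num)
    refine ne_top_of_le_ne_top (ENNReal.tsum_coe_ne_top_iff_summable.2 hs) ?_
    refine ENNReal.tsum_le_tsum fun m => ?_
    push_cast
    exact mul_le_mul_right (hR m).le _
  choose a ha using fun n => exists_lintegral_conv_diracProba_le (α n) (β n) hf
  refine ⟨a, fun ε hε => ?_⟩
  obtain ⟨m, hmε, hm0⟩ : ∃ m : ℕ, (∫⁻ x, f x ∂(ρ : Measure E)) / m < ε ∧ 0 < m :=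
    (((ENNReal.Tendsto.const_div ENNReal.tendsto_nat_nhds_top (Or.inr hρ)).eventually_lt_const
      (by simpa using hε)).and (eventually_gt_atTop 0)).exists
  refine ⟨R m, Eventually.of_forall fun n => ?_⟩
  refine le_trans ?_ hmε.le
  rw [ENNReal.le_div_iff_mul_le (Or.inl (by exact_mod_cast hm0.ne'))
    (Or.inl (ENNReal.natCast_ne_top m))]
  have h1 : (conv (α n) (diracProba (a n)) : Measure E) {x | (R m : ℝ) ≤ ‖x‖} * m ≤
      ∫⁻ x, f x ∂(conv (α n) (diracProba (a n)) : Measure E) := by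
    rw [mul_comm, ← lintegral_indicator_one (hm m),
      ← lintegral_const_mul _ (measurable_one.indicator (hm m))]
    exact lintegral_mono fun x =>
      ENNReal.le_tsum (f := fun m : ℕ => (m : ℝ≥0∞) * Set.indicator {x | (R m : ℝ) ≤ ‖x‖} 1 x) m
  refine le_trans ?_ (h1.trans ((ha n).trans (by rw [h n])))
  gcongr with x
  exact le_of_lt

end Tight

/-! ### Idempotence via characteristic functions, and a translation-invariant dispersion. -/

section Spread

open scoped ENNReal NNReal

variable {E : Type*} [NormedAddCommGroup E] [InnerProductSpace ℝ E] [FiniteDimensional ℝ E]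
  [MeasurableSpace E] [BorelSpace E]

lemma ae_exp_inner_eq_one_of_charFun_eq_one {θ : ProbabilityMeasure E} {ξ : E}
    (h : charFun (θ : Measure E) ξ = 1) :
    ∀ᵐ x ∂(θ : Measure E), Complex.exp (inner ℝ x ξ * Complex.I) = 1 := by
  have hmeas : Continuous fun x : E => Complex.exp (inner ℝ x ξ * Complex.I) := by fun_prop
  have hnorm : ∀ x : E, ‖Complex.exp (inner ℝ x ξ * Complex.I)‖ = 1 := fun x =>
    Complex.norm_exp_ofReal_mul_I _
  have hint : Integrable (fun x : E => Complex.exp (inner ℝ x ξ * Complex.I)) (θ : Measure E) :=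
    Integrable.of_bound hmeas.aestronglyMeasurable 1
      (Eventually.of_forall fun x => (hnorm x).le)
  -- A nonnegative integrand with zero integral vanishes a.e.; real part 1 and modulus 1 then force
  -- the value 1.
  have h0 : ∫ x, (1 - (Complex.exp (inner ℝ x ξ * Complex.I)).re) ∂(θ : Measure E) = 0 := by
    have hre : ∫ x, (Complex.exp (inner ℝ x ξ * Complex.I)).re ∂(θ : Measure E) = 1 := by
      have := integral_re hint
      rw [charFun_apply] at h
      rw [h] at this
      simpa using this
    refine (integral_sub (integrable_const _) hint.re).trans ?_
    refine (congrArg _ hre).trans ?_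
    simp
  rw [integral_eq_zero_iff_of_nonneg
    (fun x => sub_nonneg.2 ((Complex.re_le_norm _).trans (hnorm x).le))
    ((integrable_const _).sub hint.re)] at h0
  filter_upwards [h0] with x hx
  have hx1 : (Complex.exp (inner ℝ x ξ * Complex.I)).re = 1 := by
    simp only [Pi.zero_apply] at hx
    linarith
  have hx2 := hnorm x
  rw [← sq_eq_sq₀ (norm_nonneg _) zero_le_one, ← Complex.normSq_eq_norm_sq, Complex.normSq_apply,
    hx1] at hx2
  apply Complex.ext
  · exact hx1
  · rw [Complex.one_im]
    nlinarith

lemma charFun_two_smul_eq_one {θ : ProbabilityMeasure E} {ξ : E}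
    (h : charFun (θ : Measure E) ξ = 1) : charFun (θ : Measure E) ((2 : ℝ) • ξ) = 1 := by
  rw [charFun_apply, integral_congr_ae (g := fun _ => (1 : ℂ))]
  · simp
  filter_upwards [ae_exp_inner_eq_one_of_charFun_eq_one h] with x hx
  rw [inner_smul_right]
  push_cast
  rw [mul_assoc, two_mul, Complex.exp_add, hx, one_mul]

/-- The characteristic function of `κ` is nonzero near 0, so that of `θ` equals 1 there; doubling
the argument repeatedly spreads this to all of `E`. -/
lemma eq_diracProba_zero_of_conv_eq_self {κ θ : ProbabilityMeasure E} (h : conv κ θ = κ) :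
    θ = diracProba 0 := by
  have hmul : ∀ ξ, charFun (κ : Measure E) ξ * charFun (θ : Measure E) ξ =
      charFun (κ : Measure E) ξ := fun ξ => by
    conv_rhs => rw [← h]
    exact (charFun_conv ξ).symm
  have hnear : ∀ᶠ ξ in 𝓝 (0 : E), charFun (θ : Measure E) ξ = 1 := by
    have hne : charFun (κ : Measure E) 0 ≠ 0 := by simp [charFun_zero]
    filter_upwards [(continuous_charFun (μ := (κ : Measure E))).continuousAt.eventually_ne hne]
      with ξ hξ
    exact mul_left_cancel₀ hξ ((hmul ξ).trans (mul_one _).symm)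
  have hpow : ∀ (n : ℕ) (ξ : E), charFun (θ : Measure E) ξ = 1 →
      charFun (θ : Measure E) ((2 : ℝ) ^ n • ξ) = 1 := by
    intro n
    induction n with
    | zero => intro ξ hξ; simpa using hξ
    | succ n ih =>
      intro ξ hξ
      rw [pow_succ', mul_smul]
      exact charFun_two_smul_eq_one (ih ξ hξ)
  suffices hθ : (θ : Measure E) = Measure.dirac 0 from Subtype.ext hθ
  refine Measure.ext_of_charFun (funext fun ξ => ?_)
  have hlim : Tendsto (fun n : ℕ => ((2 : ℝ)⁻¹ ^ n) • ξ) atTop (𝓝 0) := by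
    simpa using (tendsto_pow_atTop_nhds_zero_of_lt_one (by norm_num : (0 : ℝ) ≤ 2⁻¹)
      (by norm_num)).smul_const ξ
  obtain ⟨n, hn⟩ := (hlim.eventually hnear).exists
  have h1 := hpow n _ hn
  rw [smul_smul, ← mul_pow, mul_inv_cancel₀ two_ne_zero, one_pow, one_smul] at h1
  rw [h1, charFun_dirac]
  simp

/-- The norm truncated at `1`. -/
noncomputable def truncNorm : BoundedContinuousFunction E ℝ≥0 :=
  BoundedContinuousFunction.mkOfBound ⟨fun x => min 1 ‖x‖₊, by fun_prop⟩ 1 fun x y => by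
    rw [NNReal.dist_eq, abs_le]
    have h1 : ((min 1 ‖x‖₊ : ℝ≥0) : ℝ) ≤ 1 := NNReal.coe_le_coe.2 (min_le_left _ _)
    have h2 : ((min 1 ‖y‖₊ : ℝ≥0) : ℝ) ≤ 1 := NNReal.coe_le_coe.2 (min_le_left _ _)
    have h3 := (min 1 ‖x‖₊).coe_nonneg
    have h4 := (min 1 ‖y‖₊).coe_nonneg
    constructor
    · simp only [ContinuousMap.coe_mk]; linarith
    · simp only [ContinuousMap.coe_mk]; linarith

lemma truncNorm_apply (x : E) : truncNorm x = min 1 ‖x‖₊ := rfl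

lemma measurable_truncNorm : Measurable fun x : E => (truncNorm x : ℝ≥0∞) :=
  truncNorm.continuous.measurable.coe_nnreal_ennreal

lemma tendsto_diracProba_zero_of_lintegral_truncNorm {ι : Type*} {l : Filter ι}
    [l.IsCountablyGenerated] {ρ : ι → ProbabilityMeasure E}
    (h : Tendsto (fun i => ∫⁻ x, truncNorm x ∂(ρ i : Measure E)) l (𝓝 0)) :
    Tendsto ρ l (𝓝 (diracProba 0)) := by
  refine tendsto_diracProba_of_forall_mem_nhds fun s hs => ?_
  obtain ⟨ε, hε, hs⟩ := Metric.mem_nhds_iff.1 hs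
  let δ : ℝ≥0 := min 1 ⟨ε, hε.le⟩
  have hδ : 0 < δ := lt_min one_pos hε
  have hsub : sᶜ ⊆ {x | (δ : ℝ≥0∞) ≤ truncNorm x} := by
    intro x hx
    have hx' : ε ≤ ‖x‖ := by
      by_contra! hlt
      exact hx (hs (by simpa using hlt))
    change (δ : ℝ≥0∞) ≤ truncNorm x
    rw [truncNorm_apply]
    exact_mod_cast min_le_min_left 1 (show (⟨ε, hε.le⟩ : ℝ≥0) ≤ ‖x‖₊ from hx')
  have hlim : Tendsto (fun i => (∫⁻ x, truncNorm x ∂(ρ i : Measure E)) / δ) l (𝓝 0) := by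
    simpa using ENNReal.Tendsto.div_const h (Or.inr (ENNReal.coe_ne_zero.2 hδ.ne'))
  refine tendsto_of_tendsto_of_tendsto_of_le_of_le tendsto_const_nhds hlim (fun _ => zero_le)
    fun i => (measure_mono hsub).trans ?_
  exact meas_ge_le_lintegral_div measurable_truncNorm.aemeasurable
    (ENNReal.coe_ne_zero.2 hδ.ne') ENNReal.coe_ne_top

/-- The least mean truncated distance of a translate of `κ` from the origin. -/
noncomputable def spread (κ : ProbabilityMeasure E) : ℝ≥0∞ :=
  ⨅ a : E, ∫⁻ x, truncNorm x ∂(conv κ (diracProba a) : Measure E)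

lemma spread_ne_top (κ : ProbabilityMeasure E) : spread κ ≠ ∞ := by
  refine ne_top_of_le_ne_top ENNReal.one_ne_top ((iInf_le _ 0).trans ?_)
  refine (lintegral_mono (g := fun _ => 1) fun x => ?_).trans (by simp)
  exact ENNReal.coe_le_one_iff.2 (min_le_left _ _)

/-- Averaging again: replacing the other factor by a well-chosen point mass does not increase the
mean truncated norm. -/
lemma spread_right_le_spread_conv (α β : ProbabilityMeasure E) :
    spread β ≤ spread (conv α β) := by
  refine le_iInf fun a => ?_
  obtain ⟨b, hb⟩ := exists_lintegral_conv_diracProba_le β (conv α (diracProba a))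
    measurable_truncNorm
  refine (iInf_le _ b).trans (hb.trans_eq ?_)
  rw [conv_left_comm, conv_assoc]

/-- Measures whose spread is arbitrarily small along an antitone sequence concentrate at the
origin after suitable translations. -/
lemma exists_tendsto_conv_diracProba {κ : ℕ → ProbabilityMeasure E}
    (hanti : Antitone fun n => spread (κ n)) {l : Filter ℕ} [l.NeBot] {a : ℕ → E}
    (h : Tendsto (fun n => conv (κ n) (diracProba (a n))) l (𝓝 (diracProba 0))) :
    ∃ b : ℕ → E, Tendsto (fun n => conv (κ n) (diracProba (b n))) atTop (𝓝 (diracProba 0)) := by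
  have h1 := (ProbabilityMeasure.tendsto_iff_forall_lintegral_tendsto.1 h) truncNorm
  have h0 : ∫⁻ x, truncNorm x ∂(diracProba (0 : E) : Measure E) = 0 := by
    refine (lintegral_dirac' (0 : E) measurable_truncNorm).trans ?_
    simp [truncNorm_apply]
  rw [h0] at h1
  have hs : Tendsto (fun n => spread (κ n)) atTop (𝓝 0) := by
    refine ENNReal.tendsto_nhds_zero.2 fun ε hε => ?_
    obtain ⟨m, hm⟩ := (h1.eventually_lt_const hε).exists
    filter_upwards [eventually_ge_atTop m] with n hn
    exact (hanti hn).trans ((iInf_le _ (a m)).trans hm.le)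
  -- The slack `1/n` avoids attaining the infimum; at `n = 0` it is `∞`, which is harmless.
  have hb : ∀ n : ℕ, ∃ b : E, ∫⁻ x, truncNorm x ∂(conv (κ n) (diracProba b) : Measure E) <
      spread (κ n) + (n : ℝ≥0∞)⁻¹ := fun n =>
    iInf_lt_iff.1 (ENNReal.lt_add_right (spread_ne_top _)
      (ENNReal.inv_ne_zero.2 (ENNReal.natCast_ne_top n)))
  choose b hb using hb
  refine ⟨b, tendsto_diracProba_zero_of_lintegral_truncNorm ?_⟩
  have hlim := hs.add ENNReal.tendsto_inv_nat_nhds_zero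
  rw [add_zero] at hlim
  exact tendsto_of_tendsto_of_tendsto_of_le_of_le tendsto_const_nhds hlim (fun _ => zero_le)
    fun n => (hb n).le

end Spread

/-! ### The equation without `φ`: division and existence. -/

section Untwisted

variable {E : Type*} [NormedAddCommGroup E] [InnerProductSpace ℝ E] [FiniteDimensional ℝ E]
  [MeasurableSpace E] [BorelSpace E]

/-- `x` solves `x_k = η_k * x_{k-1}` for all `k ∈ ℤ`. -/
def IsConvSolution (η x : ℤ → ProbabilityMeasure E) : Prop :=
  ∀ k, x k = conv (η k) (x (k - 1))

lemma IsConvSolution.conv_exchange {η x y : ℤ → ProbabilityMeasure E} (hx : IsConvSolution η x)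
    (hy : IsConvSolution η y) {j k : ℤ} (hjk : j ≤ k) :
    conv (x k) (y j) = conv (y k) (x j) := by
  induction k, hjk using Int.leInduction with
  | base => exact conv_comm _ _
  | succ k _ ih => rw [hx (k + 1), hy (k + 1), add_sub_cancel_right, conv_assoc, conv_assoc, ih]

/-- A solution whose past concentrates, after suitable translations, at the origin divides every
other solution. -/
theorem IsConvSolution.exists_eq_conv {η x y : ℤ → ProbabilityMeasure E}
    (hx : IsConvSolution η x) (hy : IsConvSolution η y) {b : ℕ → E}
    (hb : Tendsto (fun n : ℕ => conv (x (-n)) (diracProba (b n))) atTop (𝓝 (diracProba 0))) :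
    ∃ ν, ∀ k, y k = conv (x k) ν := by
  have hid : ∀ k : ℤ, ∀ᶠ n : ℕ in atTop,
      conv (y k) (conv (x (-n)) (diracProba (b n))) =
        conv (x k) (conv (y (-n)) (diracProba (b n))) := by
    intro k
    filter_upwards [eventually_ge_atTop (-k).toNat] with n hn
    rw [← conv_assoc, ← conv_assoc, hy.conv_exchange hx (by omega)]
  have hlim : ∀ k : ℤ, Tendsto (fun n : ℕ => conv (y k) (conv (x (-n)) (diracProba (b n)))) atTop
      (𝓝 (y k)) := fun k => by
    simpa only [conv_diracProba_zero] using tendsto_conv tendsto_const_nhds hb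
  have htight : TightSeq fun n : ℕ => conv (y (-n)) (diracProba (b n)) :=
    (tightSeq_of_tendsto (hlim 0)).of_conv (tightSeq_const (x 0)) (hid 0)
  obtain ⟨ν, hν⟩ := htight.exists_tendsto (U := hyperfilter ℕ)
  refine ⟨ν, fun k => ?_⟩
  have hle : (hyperfilter ℕ : Filter ℕ) ≤ atTop := Nat.hyperfilter_le_atTop
  exact tendsto_nhds_unique ((hlim k).mono_left hle)
    ((tendsto_conv tendsto_const_nhds hν).congr' (((hid k).filter_mono hle).mono
      fun n hn => hn.symm))

/-- The convolution product `η_k * η_{k-1} * ⋯ * η_{k-n+1}`. -/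
noncomputable def backProd (η : ℤ → ProbabilityMeasure E) : ℤ → ℕ → ProbabilityMeasure E
  | _, 0 => diracProba 0
  | k, n + 1 => conv (η k) (backProd η (k - 1) n)

lemma backProd_add (η : ℤ → ProbabilityMeasure E) (k : ℤ) (m n : ℕ) :
    backProd η k (m + n) = conv (backProd η k m) (backProd η (k - m) n) := by
  induction m generalizing k with
  | zero => simp [backProd, diracProba_zero_conv]
  | succ m ih =>
    rw [Nat.succ_add, backProd, backProd, ih, conv_assoc]
    congr 3
    push_cast
    ring

lemma IsConvSolution.eq_conv_backProd {η x : ℤ → ProbabilityMeasure E} (hx : IsConvSolution η x)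
    (k : ℤ) (n : ℕ) : x k = conv (backProd η k n) (x (k - n)) := by
  induction n generalizing k with
  | zero => simp [backProd, diracProba_zero_conv]
  | succ n ih =>
    rw [hx k, ih (k - 1), backProd, conv_assoc]
    congr 3
    push_cast
    ring

/-- If `x_k = η_k * x_{k-1}` is solvable, then it has a solution whose past concentrates, after
suitable translations, at the origin. -/
theorem IsConvSolution.exists_concentrating {η y : ℤ → ProbabilityMeasure E}
    (hy : IsConvSolution η y) : ∃ (x : ℤ → ProbabilityMeasure E) (b : ℕ → E),
      IsConvSolution η x ∧
      Tendsto (fun n : ℕ => conv (x (-n)) (diracProba (b n))) atTop (𝓝 (diracProba 0)) := by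
  obtain ⟨a, ha⟩ := exists_tightSeq_conv_diracProba (ρ := y 0) (α := fun n => backProd η 0 n)
    (β := fun n => y (0 - n)) (fun n => (hy.eq_conv_backProd 0 n).symm)
  -- For `k + n ≥ 0` the product runs from index `k` down to `1 - n`. The lower end and the
  -- translation `a n` do not depend on `k`, so `G` satisfies the recursion in `k` for large `n`.
  let G : ℤ → ℕ → ProbabilityMeasure E := fun k n =>
    conv (backProd η k (k + n).toNat) (diracProba (a n))
  have hle : (hyperfilter ℕ : Filter ℕ) ≤ atTop := Nat.hyperfilter_le_atTop
  have hG : ∀ k : ℤ, ∀ᶠ n in atTop, G k n = conv (η k) (G (k - 1) n) := by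
    intro k
    filter_upwards [eventually_ge_atTop (1 - k).toNat] with n hn
    have h1 : (k + n).toNat = (k - 1 + n).toNat + 1 := by omega
    simp only [G]
    rw [h1, backProd, conv_assoc]
  -- `G (-m) n` is a cofactor of the constant `backProd η 0 m` in the tight `G 0 n`; positive
  -- indices follow by convolving forward.
  have hGneg : ∀ m : ℕ, ∃ κ, Tendsto (G (-m)) (hyperfilter ℕ) (𝓝 κ) := by
    intro m
    refine (ha.of_conv (tightSeq_const (backProd η 0 m)) ?_).exists_tendsto
    filter_upwards [eventually_ge_atTop m] with n hn
    have h1 : n = m + (-(m : ℤ) + n).toNat := by omega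
    simp only [G]
    rw [← conv_assoc]
    conv_lhs => rw [h1, backProd_add]
    rw [zero_sub, ← h1]
  have hGpos : ∀ m : ℕ, ∃ κ, Tendsto (G m) (hyperfilter ℕ) (𝓝 κ) := by
    intro m
    induction m with
    | zero => simpa using hGneg 0
    | succ m ih =>
      obtain ⟨κ, hκ⟩ := ih
      refine ⟨conv (η (m + 1 : ℕ)) κ, ?_⟩
      refine (tendsto_conv tendsto_const_nhds hκ).congr' ?_
      filter_upwards [(hG (m + 1 : ℕ)).filter_mono hle] with n hn
      rw [hn]
      simp
  have hGlim : ∀ k : ℤ, ∃ κ, Tendsto (G k) (hyperfilter ℕ) (𝓝 κ) := by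
    intro k
    obtain ⟨m, rfl | rfl⟩ := k.eq_nat_or_neg
    exacts [hGpos m, hGneg m]
  choose x hx using hGlim
  have hsol : IsConvSolution η x := fun k =>
    tendsto_nhds_unique ((hx k).congr' ((hG k).filter_mono hle))
      (tendsto_conv tendsto_const_nhds (hx (k - 1)))
  -- The opposite translations cancel, so both factors are tight and the limit reads `x 0 = x 0 *
  -- θ`.
  have hx0 : ∀ n : ℕ, x 0 = conv (G 0 n) (conv (x (-n)) (diracProba (-a n))) := by
    intro n
    have h1 : conv (G 0 n) (conv (x (-n)) (diracProba (-a n))) =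
        conv (backProd η 0 n)
          (conv (x (-n)) (conv (diracProba (a n)) (diracProba (-a n)))) := by
      simp only [G, zero_add, Int.toNat_natCast]
      rw [conv_assoc, conv_left_comm (diracProba (a n))]
    rw [h1, conv_diracProba_diracProba, add_neg_cancel, conv_diracProba_zero]
    simpa using hsol.eq_conv_backProd 0 n
  have hG0 : TightSeq (G 0) := by
    simpa [G] using ha
  obtain ⟨θ, hθ⟩ := ((tightSeq_const (x 0)).of_conv hG0
    (Eventually.of_forall hx0)).exists_tendsto (U := hyperfilter ℕ)
  have hθ0 : θ = diracProba 0 := by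
    refine eq_diracProba_zero_of_conv_eq_self (κ := x 0) ?_
    refine tendsto_nhds_unique (tendsto_conv (hx 0) hθ) ?_
    exact tendsto_const_nhds.congr hx0
  rw [hθ0] at hθ
  have hanti : Antitone fun n : ℕ => spread (x (-n)) := by
    refine antitone_nat_of_succ_le fun n => ?_
    have h1 : x (-n) = conv (η (-n)) (x (-(n + 1 : ℕ))) := by
      rw [hsol (-n)]
      congr 2
      push_cast
      ring
    rw [h1]
    exact spread_right_le_spread_conv _ _
  obtain ⟨b, hb⟩ := exists_tendsto_conv_diracProba (κ := fun n : ℕ => x (-n)) hanti hθ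
  exact ⟨x, b, hsol, hb⟩

end Untwisted

/-! ### Product laws on bi-sequences. -/

section Product

variable {d : ℕ}

/-- Finite-dimensional marginals determine the law, and there characteristic functions factor over
the coordinates. -/
lemma productLaw_conv (α β : ℤ → ProbabilityMeasure (Euc d)) :
    productLaw (fun k => conv (α k) (β k)) = conv (productLaw α) (productLaw β) := by
  classical
  refine Subtype.ext ?_
  change Measure.infinitePi (fun k => (conv (α k) (β k) : Measure (Euc d))) =
    Measure.conv (Measure.infinitePi fun k => (α k : Measure (Euc d)))
      (Measure.infinitePi fun k => (β k : Measure (Euc d)))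
  refine (Measure.isProjectiveLimit_infinitePi _).unique fun I => ?_
  let r : BiSeq d →L[ℝ] (I → Euc d) :=
    ContinuousLinearMap.pi fun i => ContinuousLinearMap.proj (i : ℤ)
  change Measure.map r _ = _
  rw [Measure.map_conv_continuousLinearMap r]
  have hr : ∀ γ : ℤ → ProbabilityMeasure (Euc d),
      (Measure.infinitePi fun k => (γ k : Measure (Euc d))).map r =
        Measure.pi fun i : I => (γ i : Measure (Euc d)) := fun γ =>
    Measure.infinitePi_map_restrict _
  rw [hr, hr]
  refine Measure.ext_of_charFunDual (funext fun L => ?_)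
  rw [charFunDual_conv, charFunDual_pi, charFunDual_pi, charFunDual_pi, ← Finset.prod_mul_distrib]
  exact Finset.prod_congr rfl fun i _ => (charFunDual_conv _).symm

lemma productLaw_diracProba (v : BiSeq d) :
    productLaw (fun k => diracProba (v k)) = diracProba v :=
  Subtype.ext (Measure.infinitePi_dirac v)

lemma image_coordProj_productLaw (α : ℤ → ProbabilityMeasure (Euc d)) (k : ℤ) :
    image (coordProj k) (productLaw α) = α k :=
  Subtype.ext (Measure.infinitePi_map_eval _ k)

lemma image_weightedShift_productLaw (φ : Euc d →L[ℝ] Euc d)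
    (α : ℤ → ProbabilityMeasure (Euc d)) :
    image (weightedShift φ) (productLaw α) = productLaw fun k => image φ (α (k - 1)) := by
  refine Subtype.ext ?_
  have h1 := Measure.map_infinitePi_infinitePi_of_inj
    (P := fun k => (α k : Measure (Euc d))) (sub_left_injective (b := (1 : ℤ)))
  have h2 := Measure.infinitePi_map_pi (fun k => (α (k - 1) : Measure (Euc d)))
    (f := fun _ => φ) fun _ => φ.continuous.measurable
  refine Eq.trans ?_ h2
  rw [← h1]
  have hf : Measurable fun (w : BiSeq d) (k : ℤ) => w (k - 1) := by fun_prop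
  have hg : Measurable fun (w : BiSeq d) (k : ℤ) => φ (w k) := by fun_prop
  exact (Measure.map_map hg hf).symm

/-- A basic neighbourhood in the product constrains finitely many coordinates, so a union bound
suffices. -/
lemma tendsto_diracProba_of_coordProj {ρ : ℕ → ProbabilityMeasure (BiSeq d)}
    (h : ∀ k, Tendsto (fun n => image (coordProj k) (ρ n)) atTop (𝓝 (diracProba 0))) :
    Tendsto ρ atTop (𝓝 (diracProba 0)) := by
  refine tendsto_diracProba_of_forall_mem_nhds fun s hs => ?_
  rw [nhds_pi, Filter.mem_pi] at hs
  obtain ⟨I, hI, t, ht, hts⟩ := hs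
  have hsum : Tendsto (fun n => ∑ k ∈ hI.toFinset,
      (image (coordProj k) (ρ n) : Measure (Euc d)) (t k)ᶜ) atTop (𝓝 0) := by
    simpa using tendsto_finsetSum hI.toFinset fun k _ =>
      tendsto_measure_compl_of_tendsto_diracProba (h k) (ht k)
  refine tendsto_of_tendsto_of_tendsto_of_le_of_le tendsto_const_nhds hsum (fun _ => zero_le)
    fun n => ?_
  have hsub : sᶜ ⊆ ⋃ k ∈ hI.toFinset, (coordProj k : BiSeq d → Euc d) ⁻¹' (t k)ᶜ := by
    intro x hx
    by_contra hcon
    refine hx (hts fun k hk => ?_)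
    by_contra hxk
    exact hcon (Set.mem_biUnion (hI.mem_toFinset.2 hk) hxk)
  refine (measure_mono hsub).trans ((measure_biUnion_finset_le _ _).trans ?_)
  exact Finset.sum_le_sum fun k _ =>
    Measure.le_map_apply (coordProj k).continuous.measurable.aemeasurable _

end Product

/-! ### Passing between (1) and the untwisted equation. -/

section Twist

variable {d : ℕ} (φ : Euc d ≃L[ℝ] Euc d)

/-- The integer power `φ ^ k` as a continuous linear map. -/
noncomputable def zpowMap (k : ℤ) : Euc d →L[ℝ] Euc d :=
  ((φ ^ k : Euc d ≃L[ℝ] Euc d) : Euc d →L[ℝ] Euc d)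

lemma image_zpowMap_image_zpowMap (j k : ℤ) (α : ProbabilityMeasure (Euc d)) :
    image (zpowMap φ j) (image (zpowMap φ k) α) = image (zpowMap φ (j + k)) α := by
  rw [image_image, zpowMap, zpowMap, zpowMap, zpow_add]
  rfl

lemma zpowMap_zero : zpowMap φ 0 = ContinuousLinearMap.id ℝ (Euc d) := by
  rw [zpowMap, zpow_zero]
  rfl

lemma zpowMap_one : zpowMap φ 1 = (φ : Euc d →L[ℝ] Euc d) := by
  rw [zpowMap, zpow_one]

lemma image_zpowMap_zero (α : ProbabilityMeasure (Euc d)) : image (zpowMap φ 0) α = α := by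
  rw [zpowMap_zero, image_id]

lemma IsSolution.isConvSolution {μ ν : ℤ → ProbabilityMeasure (Euc d)}
    (h : IsSolution (φ : Euc d →L[ℝ] Euc d) μ ν) :
    IsConvSolution (fun k => image (zpowMap φ (-k)) (μ k))
      (fun k => image (zpowMap φ (-k)) (ν k)) := by
  intro k
  simp only
  rw [h k, image_conv, ← zpowMap_one, image_zpowMap_image_zpowMap]
  congr 3
  ring

lemma IsConvSolution.isSolution {μ x : ℤ → ProbabilityMeasure (Euc d)}
    (h : IsConvSolution (fun k => image (zpowMap φ (-k)) (μ k)) x) :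
    IsSolution (φ : Euc d →L[ℝ] Euc d) μ (fun k => image (zpowMap φ k) (x k)) := by
  intro k
  simp only
  rw [h k, image_conv, ← zpowMap_one, image_zpowMap_image_zpowMap, image_zpowMap_image_zpowMap,
    add_neg_cancel, image_zpowMap_zero, add_sub_cancel]

/-- A solution whose untwisted past concentrates at the origin up to translations is
fundamental. -/
lemma IsConvSolution.isFundamentalSolution {μ x : ℤ → ProbabilityMeasure (Euc d)}
    (h : IsConvSolution (fun k => image (zpowMap φ (-k)) (μ k)) x) {b : ℕ → Euc d}
    (hb : Tendsto (fun n : ℕ => conv (x (-n)) (diracProba (b n))) atTop (𝓝 (diracProba 0))) :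
    IsFundamentalSolution φ μ (fun k => image (zpowMap φ k) (x k)) := by
  refine ⟨h.isSolution, fun y hy => ?_⟩
  obtain ⟨ν, hν⟩ := h.exists_eq_conv (hy.isConvSolution) hb
  refine ⟨ν, fun k => ?_⟩
  have := congrArg (image (zpowMap φ k)) (hν k)
  rwa [image_zpowMap_image_zpowMap, add_neg_cancel, image_zpowMap_zero, image_conv] at this

lemma image_coordProj_image_weightedShift_pow (n : ℕ) (k : ℤ) (ρ : ProbabilityMeasure (BiSeq d)) :
    image (coordProj k) (image (weightedShift (φ : Euc d →L[ℝ] Euc d) ^ n) ρ) =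
      image (zpowMap φ n) (image (coordProj (k - n)) ρ) := by
  induction n generalizing k ρ with
  | zero =>
    rw [Nat.cast_zero, image_zpowMap_zero, sub_zero, pow_zero]
    exact congrArg _ (image_id ρ)
  | succ n ih =>
    have h1 : image (weightedShift (φ : Euc d →L[ℝ] Euc d) ^ (n + 1)) ρ =
        image (weightedShift (φ : Euc d →L[ℝ] Euc d) ^ n)
          (image (weightedShift (φ : Euc d →L[ℝ] Euc d)) ρ) := by
      rw [image_image, pow_succ]
      rfl
    have h2 : image (coordProj (k - n)) (image (weightedShift (φ : Euc d →L[ℝ] Euc d)) ρ) =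
        image (zpowMap φ 1) (image (coordProj (k - n - 1)) ρ) := by
      rw [image_image, image_image, zpowMap_one]
      rfl
    rw [h1, ih, h2, image_zpowMap_image_zpowMap]
    rw [Nat.cast_succ, sub_sub]

end Twist

/-! ### The two assertions on strong decomposability. -/

section Main

variable {d : ℕ} (φ : Euc d ≃L[ℝ] Euc d) {μ : ℤ → ProbabilityMeasure (Euc d)}

lemma isFundamentalSolution_coordProj {lam : ProbabilityMeasure (BiSeq d)}
    (h : IsStronglyDecomposable (weightedShift (φ : Euc d →L[ℝ] Euc d)) lam (productLaw μ)) :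
    IsFundamentalSolution φ μ (fun k => image (coordProj k) lam) := by
  have hsol : IsSolution (φ : Euc d →L[ℝ] Euc d) μ (fun k => image (coordProj k) lam) := by
    intro k
    have h1 := congrArg (image (coordProj k)) h.1
    rw [image_conv, image_coordProj_productLaw, image_image] at h1
    refine h1.trans ?_
    rw [image_image]
    rfl
  have hlim : Tendsto (fun n : ℕ => conv (image (zpowMap φ (-(-n : ℤ)))
      (image (coordProj (-n : ℤ)) lam)) (diracProba ((fun _ => 0 : ℕ → Euc d) n))) atTop
      (𝓝 (diracProba 0)) := by
    have h1 := tendsto_image (coordProj 0) h.2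
    rw [image_diracProba, map_zero] at h1
    refine h1.congr fun n => ?_
    rw [conv_diracProba_zero, image_coordProj_image_weightedShift_pow, neg_neg, zero_sub]
  have h2 := (hsol.isConvSolution φ).isFundamentalSolution φ hlim
  simpa only [image_zpowMap_image_zpowMap, add_neg_cancel, image_zpowMap_zero] using h2

lemma exists_isStronglyDecomposable {x : ℤ → ProbabilityMeasure (Euc d)}
    (hx : IsConvSolution (fun k => image (zpowMap φ (-k)) (μ k)) x) {b : ℕ → Euc d}
    (hb : Tendsto (fun n : ℕ => conv (x (-n)) (diracProba (b n))) atTop (𝓝 (diracProba 0))) :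
    ∃ (v : BiSeq d) (lam : ProbabilityMeasure (BiSeq d)),
      IsStronglyDecomposable (weightedShift (φ : Euc d →L[ℝ] Euc d)) lam
        (conv (productLaw μ) (diracProba v)) := by
  -- Chosen so that `c (-n) = b n`; for `k > 0` the value is the constant `b 0`. The increments of
  -- `c`, twisted by `φ^k`, form `v`, so that the translates `z` solve the equation with co-factors
  -- shifted by `v`.
  let c : ℤ → Euc d := fun k => b (-k).toNat
  let v : BiSeq d := fun k => zpowMap φ k (c k - c (k - 1))
  let z : ℤ → ProbabilityMeasure (Euc d) := fun k => conv (x k) (diracProba (c k))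
  have hz : IsConvSolution
      (fun k => image (zpowMap φ (-k)) (conv (μ k) (diracProba (v k)))) z := by
    intro k
    have h1 : image (zpowMap φ (-k)) (diracProba (v k)) = diracProba (c k - c (k - 1)) := by
      rw [← image_diracProba, image_zpowMap_image_zpowMap, neg_add_cancel, image_zpowMap_zero]
    simp only [z]
    rw [image_conv, h1, hx k, conv_assoc, conv_assoc, conv_left_comm (diracProba _),
      conv_diracProba_diracProba, sub_add_cancel]
  have hlam := hz.isSolution φ
  refine ⟨v, productLaw fun k => image (zpowMap φ k) (z k), ?_, ?_⟩
  · rw [IsDecomposable, image_weightedShift_productLaw, ← productLaw_diracProba, ← productLaw_conv,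
      ← productLaw_conv]
    exact congrArg productLaw (funext hlam)
  · refine tendsto_diracProba_of_coordProj fun k => ?_
    -- Coordinate `k` of `τ^n(lam)` is `φ^k(z (k - n))`: the powers of `φ` combine to one
    -- independent of `n`.
    have hz0 : Tendsto (fun n : ℕ => z (k - n)) atTop (𝓝 (diracProba 0)) := by
      have hshift : Tendsto (fun n : ℕ => ((n : ℤ) - k).toNat) atTop atTop := by
        refine tendsto_atTop_atTop.2 fun m => ⟨m + k.toNat, fun n hn => ?_⟩
        omega
      refine (hb.comp hshift).congr' ?_
      filter_upwards [eventually_ge_atTop k.toNat] with n hn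
      have h1 : (-(((n : ℤ) - k).toNat : ℤ)) = k - n := by omega
      simp only [Function.comp_apply, z, c]
      rw [h1, neg_sub]
    have h1 := tendsto_image (zpowMap φ k) hz0
    rw [image_diracProba, map_zero] at h1
    refine h1.congr fun n => ?_
    rw [image_coordProj_image_weightedShift_pow, image_coordProj_productLaw,
      image_zpowMap_image_zpowMap, add_sub_cancel]

end Main

end StochDiffEq

theorem mainTheorem1 (d : ℕ) (μ : ℤ → ProbabilityMeasure (StochDiffEq.Euc d))
    (φ : StochDiffEq.Euc d ≃L[ℝ] StochDiffEq.Euc d) :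
    (∀ lam : ProbabilityMeasure (StochDiffEq.BiSeq d),
      StochDiffEq.IsStronglyDecomposable
        (StochDiffEq.weightedShift (φ : StochDiffEq.Euc d →L[ℝ] StochDiffEq.Euc d))
        lam (StochDiffEq.productLaw μ) →
      StochDiffEq.IsFundamentalSolution φ μ
        (fun k => StochDiffEq.image (StochDiffEq.coordProj k) lam)) ∧
    ((∃ ν : ℤ → ProbabilityMeasure (StochDiffEq.Euc d),
        StochDiffEq.IsSolution (φ : StochDiffEq.Euc d →L[ℝ] StochDiffEq.Euc d) μ ν) →
      (∃ (v : StochDiffEq.BiSeq d) (lam : ProbabilityMeasure (StochDiffEq.BiSeq d)),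
        StochDiffEq.IsStronglyDecomposable
          (StochDiffEq.weightedShift (φ : StochDiffEq.Euc d →L[ℝ] StochDiffEq.Euc d))
          lam (StochDiffEq.conv (StochDiffEq.productLaw μ) (diracProba v))) ∧
      ∃ lam : ℤ → ProbabilityMeasure (StochDiffEq.Euc d),
        StochDiffEq.IsFundamentalSolution φ μ lam) := by
  refine ⟨fun lam h => StochDiffEq.isFundamentalSolution_coordProj φ h, ?_⟩
  rintro ⟨ν, hν⟩
  obtain ⟨x, b, hx, hb⟩ := (hν.isConvSolution φ).exists_concentrating
  exact ⟨StochDiffEq.exists_isStronglyDecomposable φ hx hb, _, hx.isFundamentalSolution φ hb⟩
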